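/- Let $n,p,m,r\ge 0$ and $0\le\varrho\le n$ be integers, $X\in\mathbb R^{n\times p}$ an arbitrary matrix, $q=\operatorname{rank}(X)$ and $\sigma\ge 0$. For $C\in\mathbb R^{n\times m}$ let $J(C)$ be the number of nonzero rows of $C$, and put $M(B,C)=\|XB+C\|_F^2$. Call a random matrix $\mathcal E\in\mathbb R^{n\times m}$ sub-Gaussian with scale $\sigma$ if $\Pr\big(|\langle \mathcal E,A\rangle|>\sigma\|A\|_F\,t\big)\le 2e^{-t^2/2}$ for all $A\in\mathbb R^{n\times m}$ and $t\ge 0$ (for example, if the entries of $\mathcal E$ are independent $N(0,\sigma^2)$). Given $Y\in\mathbb R^{n\times m}$, consider the doubly constrained problem $$\min_{B\in\mathbb R^{p\times m},\,C\in\mathbb R^{n\times m}}\ \tfrac12\|Y-XB-C\|_F^2\quad\text{subject to}\quad \operatorname{rank}(B)\le r,\ J(C)\le\varrho. \qquad (1)$$ (i) There is a universal constant $K>0$ (independent of $n,p,m,r,\varrho,X,\sigma$ and of everything below) such that the following holds. Let $Y=XB^*+C^*+\mathcal E$ with arbitrary fixed $B^*\in\mathbb R^{p\times m}$, $C^*\in\mathbb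 R^{n\times m}$ and with $\mathcal E$ sub-Gaussian with scale $\sigma$, and let $(\hat B,\hat C)$ be a global minimizer of (1). Then, with the convention $0\log(en/0)=0$, $$E\{M(\hat B-B^*,\hat C-C^*)\}\le K\Big[\inf_{\operatorname{rank}(B)\le r,\ J(C)\le\varrho}M(B-B^*,C-C^*)+\sigma^2\{(q+m)r+\varrho m+\varrho\log(en/\varrho)\}+\sigma^2\Big].$$ (ii) Let $Y\mapsto(\hat B(Y),\hat C(Y))$ be an estimator that returns, for every $Y$, a global minimizer of (1), and fix $B\in\mathbb R^{p\times m}$. Its risk-based finite-sample breakdown point is $$\epsilon^*=\frac1n\min\Big\{k\in\mathbb N\cup\{0\}:\ \sup\, E\{M(\hat B(Y)-B,\hat C(Y)-C)\}=+\infty\Big\},\qquad Y=XB+C+\mathcal E,$$ where the supremum is over all $C\in\mathbb R^{n\times m}$ with $J(C)\le k$ and over all laws of $\mathcal E$ that are sub-Gaussian with scale $\sigma$, and $\min\emptyset=+\infty$. Then $\epsilon^*\ge(\varrho+1)/n$. -/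

import Mathlib

open MeasureTheory
open scoped ENNReal

noncomputable section

namespace RobustRRR

section Frobenius
open scoped Matrix.Norms.Frobenius

/-- The Frobenius norm of a real matrix (Mathlib's `Matrix.frobeniusNormedAddCommGroup`). -/
def frobNorm {n m : ℕ} (A : Matrix (Fin n) (Fin m) ℝ) : ℝ := ‖A‖

end Frobenius

/-- The number of nonzero rows of a matrix. -/
def rowSparsity {n m : ℕ} (C : Matrix (Fin n) (Fin m) ℝ) : ℕ :=
  Set.ncard {i : Fin n | C i ≠ 0}

/-- The prediction error functional `M(B, C) = ‖X B + C‖_F ^ 2`. -/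
def predError {n p m : ℕ} (X : Matrix (Fin n) (Fin p) ℝ)
    (B : Matrix (Fin p) (Fin m) ℝ) (C : Matrix (Fin n) (Fin m) ℝ) : ℝ :=
  frobNorm (X * B + C) ^ 2

/-- The feasible set: pairs `(B, C)` with `rank B ≤ r` and at most `ϱ` nonzero rows in `C`. -/
def feasible (n p m r ϱ : ℕ) :
    Set (Matrix (Fin p) (Fin m) ℝ × Matrix (Fin n) (Fin m) ℝ) :=
  {D | D.1.rank ≤ r ∧ rowSparsity D.2 ≤ ϱ}

/-- `D = (B, C)` is a global minimizer of `‖Y - X B - C‖_F ^ 2 / 2` over the feasible set. -/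
def IsSolution {n p m : ℕ} (X : Matrix (Fin n) (Fin p) ℝ) (Y : Matrix (Fin n) (Fin m) ℝ)
    (r ϱ : ℕ) (D : Matrix (Fin p) (Fin m) ℝ × Matrix (Fin n) (Fin m) ℝ) : Prop :=
  D ∈ feasible n p m r ϱ ∧
    IsMinOn (fun D' => (1 / 2 : ℝ) * frobNorm (Y - X * D'.1 - D'.2) ^ 2)
      (feasible n p m r ϱ) D

/-- The product (Borel) σ-algebra on real matrices. -/
instance matrixMeasurableSpace {n m : ℕ} : MeasurableSpace (Matrix (Fin n) (Fin m) ℝ) :=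
  inferInstanceAs (MeasurableSpace (Fin n → Fin m → ℝ))

/-- The random matrix `E` (equivalently, its vectorization) is sub-Gaussian with scale
parameter `σ`: every one-dimensional marginal `⟨E, A⟩ = ∑ i, ∑ j, E i j * A i j` satisfies
`P(|⟨E, A⟩| > σ ‖A‖_F t) ≤ 2 exp(-t ^ 2 / 2)` for all `t ≥ 0`. No independence of the entries
is required. -/
structure IsSubGaussian {Ω : Type*} [MeasurableSpace Ω] {n m : ℕ}
    (E : Ω → Matrix (Fin n) (Fin m) ℝ) (σ : ℝ) (μ : Measure Ω) : Prop where
  aemeasurable : AEMeasurable E μ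
  tail : ∀ (A : Matrix (Fin n) (Fin m) ℝ) (t : ℝ), 0 ≤ t →
    μ {ω | σ * frobNorm A * t < |∑ i, ∑ j, E ω i j * A i j|}
      ≤ ENNReal.ofReal (2 * Real.exp (-t ^ 2 / 2))

/-- The best approximation error
`inf {M(B - Bstar, C - Cstar) : rank B ≤ r, C has at most ϱ nonzero rows}`. -/
def bestApproxError {n p m : ℕ} (X : Matrix (Fin n) (Fin p) ℝ)
    (Bstar : Matrix (Fin p) (Fin m) ℝ) (Cstar : Matrix (Fin n) (Fin m) ℝ) (r ϱ : ℕ) : ℝ :=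
  sInf ((fun D => predError X (D.1 - Bstar) (D.2 - Cstar)) '' feasible n p m r ϱ)

/-- The risk `E M(Bhat(Y) - B, Chat(Y) - C)` of the estimator `est = (Bhat, Chat)` when
`Y = X B + C + E` and the noise `E` has law `ν`. -/
def risk {n p m : ℕ} (X : Matrix (Fin n) (Fin p) ℝ)
    (est : Matrix (Fin n) (Fin m) ℝ → Matrix (Fin p) (Fin m) ℝ × Matrix (Fin n) (Fin m) ℝ)
    (B : Matrix (Fin p) (Fin m) ℝ) (C : Matrix (Fin n) (Fin m) ℝ)
    (ν : Measure (Matrix (Fin n) (Fin m) ℝ)) : ℝ≥0∞ :=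
  ∫⁻ E, ENNReal.ofReal
    (predError X ((est (X * B + C + E)).1 - B) ((est (X * B + C + E)).2 - C)) ∂ν

/-- The worst-case risk over all contaminations `C` with at most `k` nonzero rows and all
sub-Gaussian noise laws of scale `σ`. -/
def worstRisk {n p m : ℕ} (X : Matrix (Fin n) (Fin p) ℝ)
    (est : Matrix (Fin n) (Fin m) ℝ → Matrix (Fin p) (Fin m) ℝ × Matrix (Fin n) (Fin m) ℝ)
    (B : Matrix (Fin p) (Fin m) ℝ) (σ : ℝ) (k : ℕ) : ℝ≥0∞ :=
  ⨆ (C : Matrix (Fin n) (Fin m) ℝ) (_ : rowSparsity C ≤ k)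
    (ν : Measure (Matrix (Fin n) (Fin m) ℝ)) (_ : IsProbabilityMeasure ν)
    (_ : IsSubGaussian (fun E => E) σ ν), risk X est B C ν

/-- The risk-based finite-sample breakdown point
`(1 / n) * min {k : worst-case risk with k contaminated rows is infinite}`, with value `∞`
if there is no such `k`. -/
def breakdownPoint {n p m : ℕ} (X : Matrix (Fin n) (Fin p) ℝ)
    (est : Matrix (Fin n) (Fin m) ℝ → Matrix (Fin p) (Fin m) ℝ × Matrix (Fin n) (Fin m) ℝ)
    (B : Matrix (Fin p) (Fin m) ℝ) (σ : ℝ) : ℝ≥0∞ :=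
  ⨅ (k : ℕ) (_ : worstRisk X est B σ k = ∞), (k : ℝ≥0∞) / n

end RobustRRR

end

/-! Comparing the minimizer with any feasible competitor gives a basic inequality whose only random
term is `⟨E, Δ⟩`, where `Δ` is the difference of the two fits. If `|⟨E, Δ⟩| ≤ t ‖Δ‖` uniformly over
such `Δ`, completing squares absorbs this term at the price of a multiple of `t ^ 2`
(`predError_le_of_isSolution`).

Each `Δ` is `X B + C` with `rank B ≤ 2 r` and `C` supported on a union `I` of two `ϱ`-sets. Cutting
`Δ` into its rows off `I` and on `I` separates the two structures orthogonally: off `I` it has low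
rank with columns in a fixed space of dimension at most `rank X`, and on `I` it is arbitrary.
Half-nets for the factors of the first part and for the second part, united over all pairs of
supports, give a finite test set whose log-cardinality is of the order of the complexity
(`exists_testSet`). A maximal inequality over this set needs only the one-dimensional tails
(`IsSubGaussian.lintegral_max_sq_le`).

For the breakdown point, when `C` has at most `ϱ` nonzero rows the competitor `(0, C)` is feasible
with error `‖X B‖ ^ 2`. The oracle inequality then bounds the risk uniformly in `C` and in the noise
law. -/

namespace RobustRRR

/-! ### Half-nets of unit balls and control of linear and bilinear forms. -/

section Nets

/-- `s` is a `1 / 2`-net of the closed unit ball. -/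
structure IsHalfNet {V : Type*} [NormedAddCommGroup V] (s : Finset V) : Prop where
  norm_le : ∀ c ∈ s, ‖c‖ ≤ 1
  exists_near : ∀ v : V, ‖v‖ ≤ 1 → ∃ c ∈ s, ‖v - c‖ ≤ 1 / 2

theorem IsHalfNet.nonempty {V : Type*} [NormedAddCommGroup V] {s : Finset V}
    (hs : IsHalfNet s) : s.Nonempty := by
  obtain ⟨c, hc, -⟩ := hs.exists_near 0 (by simp)
  exact ⟨c, hc⟩

variable {V W : Type*} [NormedAddCommGroup V] [NormedSpace ℝ V] [FiniteDimensional ℝ V]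
  [NormedAddCommGroup W] [NormedSpace ℝ W] [FiniteDimensional ℝ W]

variable (V) in
/-- The unit ball of a normed space of dimension `d` has a `1 / 2`-net with at most `5 ^ d`
points. -/
theorem exists_isHalfNet :
    ∃ s : Finset V, IsHalfNet s ∧ s.card ≤ 5 ^ Module.finrank ℝ V := by
  classical
  -- Sets in the unit ball with pairwise distances at least `1 / 2`. Doubling makes the separation
  -- `1` and the radius `2`, the setting of the Besicovitch bound `5 ^ d`.
  let P : Finset V → Prop := fun s =>
    (∀ c ∈ s, ‖c‖ ≤ 1) ∧ ∀ c ∈ s, ∀ d ∈ s, c ≠ d → 1 / 2 ≤ ‖c - d‖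
  have hcard : ∀ s, P s → s.card ≤ 5 ^ Module.finrank ℝ V := by
    intro s hs
    have hinj : Function.Injective fun x : V => (2 : ℝ) • x :=
      smul_right_injective V two_ne_zero
    rw [← Finset.card_image_of_injective s hinj]
    apply Besicovitch.card_le_of_separated
    · intro c hc
      obtain ⟨x, hx, rfl⟩ := Finset.mem_image.1 hc
      have := hs.1 x hx
      simp only [norm_smul, Real.norm_ofNat]
      linarith
    · intro c hc d hd hcd
      obtain ⟨x, hx, rfl⟩ := Finset.mem_image.1 hc
      obtain ⟨y, hy, rfl⟩ := Finset.mem_image.1 hd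
      have := hs.2 x hx y hy (fun h => hcd (by rw [h]))
      simp only [← smul_sub, norm_smul, Real.norm_ofNat]
      linarith
  -- A separated set of largest cardinality is a net: a point farther than `1 / 2` from all of it
  -- could be added.
  let Q : ℕ → Prop := fun k => ∃ s, P s ∧ s.card = k
  have hQ : Q (Nat.findGreatest Q (5 ^ Module.finrank ℝ V)) :=
    Nat.findGreatest_spec (m := 0) (Nat.zero_le _) ⟨∅, by simp [P], rfl⟩
  obtain ⟨s, hs, hsc⟩ := hQ
  refine ⟨s, ⟨hs.1, fun v hv => ?_⟩, hcard s hs⟩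
  by_contra! hfar
  have hvs : v ∉ s := fun h => by
    have := hfar v h
    norm_num at this
  have hP : P (insert v s) := by
    refine ⟨?_, ?_⟩
    · intro c hc
      rcases Finset.mem_insert.1 hc with rfl | hc
      exacts [hv, hs.1 c hc]
    · intro c hc d hd hcd
      rcases Finset.mem_insert.1 hc with h | hc' <;> rcases Finset.mem_insert.1 hd with h' | hd'
      · exact absurd (h.trans h'.symm) hcd
      · exact h ▸ (hfar d hd').le
      · rw [norm_sub_rev]
        exact h' ▸ (hfar c hc').le
      · exact hs.2 c hc' d hd' hcd
  have h1 := Nat.le_findGreatest (P := Q) (hcard _ hP) ⟨_, hP, rfl⟩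
  rw [← hsc, Finset.card_insert_of_notMem hvs] at h1
  omega

/-- A linear form is controlled by its values on a `1 / 2`-net. -/
theorem IsHalfNet.abs_apply_le {s : Finset V} (hs : IsHalfNet s) (f : V →ₗ[ℝ] ℝ) {t : ℝ}
    (ht : ∀ c ∈ s, |f c| ≤ t) (v : V) : |f v| ≤ 2 * t * ‖v‖ := by
  have h0 : 0 ≤ t := by
    obtain ⟨c, hc⟩ := hs.nonempty
    exact (abs_nonneg _).trans (ht c hc)
  let g : V →L[ℝ] ℝ := LinearMap.toContinuousLinearMap f
  have hg : ∀ x, g x = f x := fun x => rfl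
  -- Self-bounding: moving to the nearest net point costs at most half the norm of `g`, so `‖g‖ ≤ 2
  -- t`.
  have key : ‖g‖ ≤ t + ‖g‖ / 2 := by
    apply ContinuousLinearMap.opNorm_le_of_unit_norm (by positivity)
    intro x hx
    obtain ⟨c, hc, hxc⟩ := hs.exists_near x hx.le
    have h1 : g x = g c + g (x - c) := by rw [← map_add]; simp
    calc ‖g x‖ ≤ ‖g c‖ + ‖g (x - c)‖ := h1 ▸ norm_add_le _ _
      _ ≤ t + ‖g‖ * (1 / 2) := add_le_add (ht c hc)
          ((g.le_opNorm _).trans (by gcongr))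
      _ = _ := by ring
  calc |f v| = ‖g v‖ := rfl
    _ ≤ ‖g‖ * ‖v‖ := g.le_opNorm v
    _ ≤ _ := by gcongr; linarith

/-- A bilinear form is controlled by its values on a product of `1 / 2`-nets. -/
theorem IsHalfNet.abs_apply_apply_le {s : Finset V} {s' : Finset W} (hs : IsHalfNet s)
    (hs' : IsHalfNet s') (b : V →ₗ[ℝ] W →ₗ[ℝ] ℝ) {t : ℝ}
    (ht : ∀ c ∈ s, ∀ d ∈ s', |b c d| ≤ t) (v : V) (w : W) :
    |b v w| ≤ 4 * t * ‖v‖ * ‖w‖ := by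
  have h1 : ∀ d ∈ s', |b v d| ≤ 2 * t * ‖v‖ := fun d hd =>
    hs.abs_apply_le (b.flip d) (fun c hc => ht c hc d hd) v
  calc |b v w| ≤ 2 * (2 * t * ‖v‖) * ‖w‖ := hs'.abs_apply_le (b v) h1 w
    _ = _ := by ring

end Nets

/-! ### Frobenius norm and inner product. -/

section Frobenius

variable {n m : ℕ}

/-- The Frobenius inner product. -/
noncomputable def frobInner (E A : Matrix (Fin n) (Fin m) ℝ) : ℝ := ∑ i, ∑ j, E i j * A i j

theorem frobNorm_nonneg (A : Matrix (Fin n) (Fin m) ℝ) : 0 ≤ frobNorm A :=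
  @norm_nonneg _ Matrix.frobeniusSeminormedAddCommGroup.toSeminormedAddGroup A

theorem frobNorm_sq (A : Matrix (Fin n) (Fin m) ℝ) :
    frobNorm A ^ 2 = ∑ i, ∑ j, A i j ^ 2 := by
  have h0 : 0 ≤ ∑ i, ∑ j, A i j ^ 2 := by positivity
  have : frobNorm A = Real.sqrt (∑ i, ∑ j, A i j ^ 2) := by
    rw [frobNorm, Matrix.frobenius_norm_def, Real.sqrt_eq_rpow]
    simp
  rw [this, Real.sq_sqrt h0]

theorem frobNorm_sub_le (A B : Matrix (Fin n) (Fin m) ℝ) :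
    frobNorm (A - B) ≤ frobNorm A + frobNorm B :=
  @norm_sub_le _ Matrix.frobeniusSeminormedAddCommGroup.toSeminormedAddGroup A B

theorem frobInner_add (E A B : Matrix (Fin n) (Fin m) ℝ) :
    frobInner E (A + B) = frobInner E A + frobInner E B := by
  simp [frobInner, mul_add, Finset.sum_add_distrib]

theorem frobNorm_sub_sq (A B : Matrix (Fin n) (Fin m) ℝ) :
    frobNorm (A - B) ^ 2 = frobNorm A ^ 2 - 2 * frobInner A B + frobNorm B ^ 2 := by
  simp only [frobNorm_sq, frobInner, Finset.mul_sum, ← Finset.sum_add_distrib,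
    ← Finset.sum_sub_distrib, Matrix.sub_apply]
  refine Finset.sum_congr rfl fun i _ => Finset.sum_congr rfl fun j _ => by ring

end Frobenius

/-! ### Test matrices for low-rank matrices with columns in a fixed subspace. -/

section LowRank

variable {n m k : ℕ}

/-- The matrix whose `j`-th column is the image under `U` of the `j`-th vector of `w`. -/
def colImage {V : Submodule ℝ (EuclideanSpace ℝ (Fin n))}
    (U : EuclideanSpace ℝ (Fin k) →L[ℝ] V)
    (w : PiLp 2 fun _ : Fin m => EuclideanSpace ℝ (Fin k)) : Matrix (Fin n) (Fin m) ℝ :=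
  Matrix.of fun i j => (U (w j) : EuclideanSpace ℝ (Fin n)) i

variable {V : Submodule ℝ (EuclideanSpace ℝ (Fin n))}

theorem frobNorm_colImage_le (U : EuclideanSpace ℝ (Fin k) →L[ℝ] V)
    (w : PiLp 2 fun _ : Fin m => EuclideanSpace ℝ (Fin k)) :
    frobNorm (colImage U w) ≤ ‖U‖ * ‖w‖ := by
  refine (sq_le_sq₀ (frobNorm_nonneg _) (by positivity)).1 ?_
  rw [frobNorm_sq, Finset.sum_comm, mul_pow, PiLp.norm_sq_eq_of_L2, Finset.mul_sum]
  refine Finset.sum_le_sum fun j _ => ?_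
  calc ∑ i, colImage U w i j ^ 2 = ‖U (w j)‖ ^ 2 := by
        exact (EuclideanSpace.real_norm_sq_eq (U (w j) : EuclideanSpace ℝ (Fin n))).symm
    _ ≤ (‖U‖ * ‖w j‖) ^ 2 := by gcongr; exact U.le_opNorm _
    _ = _ := mul_pow _ _ _

/-- The bilinear form `(U, w) ↦ ⟨E, U w⟩`. -/
noncomputable def colImageForm (E : Matrix (Fin n) (Fin m) ℝ) :
    (EuclideanSpace ℝ (Fin k) →L[ℝ] V) →ₗ[ℝ]
      (PiLp 2 fun _ : Fin m => EuclideanSpace ℝ (Fin k)) →ₗ[ℝ] ℝ :=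
  LinearMap.mk₂ ℝ (fun U w => frobInner E (colImage U w))
    (by intros; simp [frobInner, colImage, mul_add, Finset.sum_add_distrib])
    (by intros; simp [frobInner, colImage, Finset.mul_sum, mul_left_comm])
    (by intros; simp [frobInner, colImage, mul_add, Finset.sum_add_distrib])
    (by intros; simp [frobInner, colImage, Finset.mul_sum, mul_left_comm])

/-- A Euclidean space of dimension at most `k` embeds isometrically into `ℝ ^ k`. -/
theorem exists_linearIsometry_euclideanSpace {T : Type*} [NormedAddCommGroup T]
    [InnerProductSpace ℝ T] [FiniteDimensional ℝ T] (h : Module.finrank ℝ T ≤ k) :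
    Nonempty (T →ₗᵢ[ℝ] EuclideanSpace ℝ (Fin k)) := by
  let b := stdOrthonormalBasis ℝ T
  let f : T →ₗ[ℝ] EuclideanSpace ℝ (Fin k) :=
    b.toBasis.constr ℝ fun i => EuclideanSpace.basisFun (Fin k) ℝ (Fin.castLE h i)
  refine ⟨f.isometryOfOrthonormal (v := b.toBasis) (by simp) ?_⟩
  have : f ∘ b.toBasis = EuclideanSpace.basisFun (Fin k) ℝ ∘ Fin.castLE h := by
    ext1 i
    simp only [Function.comp_apply, f, Module.Basis.constr_basis]
  rw [this]
  exact (EuclideanSpace.basisFun (Fin k) ℝ).orthonormal.comp _ (Fin.castLE_injective h)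

/-- Vectors spanning a space of dimension at most `k` are images of vectors of the same norms
under a contraction from `ℝ ^ k`. -/
theorem exists_contraction_of_finrank_span_le {H : Type*} [NormedAddCommGroup H]
    [InnerProductSpace ℝ H] [FiniteDimensional ℝ H] {κ : Type*} (f : κ → H)
    (hf : Module.finrank ℝ (Submodule.span ℝ (Set.range f)) ≤ k) :
    ∃ (U : EuclideanSpace ℝ (Fin k) →L[ℝ] H) (w : κ → EuclideanSpace ℝ (Fin k)),
      (∀ j, U (w j) = f j) ∧ ‖U‖ ≤ 1 ∧ ∀ j, ‖w j‖ = ‖f j‖ := by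
  obtain ⟨ι⟩ := exists_linearIsometry_euclideanSpace hf
  have hfT : ∀ j, f j ∈ Submodule.span ℝ (Set.range f) := fun j => Submodule.subset_span ⟨j, rfl⟩
  -- `U` is the adjoint of the isometry `ι` followed by the inclusion of the span; since `ι* ι = 1`,
  -- it sends `ι (f j)` back to `f j`.
  refine ⟨(Submodule.span ℝ (Set.range f)).subtypeL.comp
    (ContinuousLinearMap.adjoint ι.toContinuousLinearMap), fun j => ι ⟨f j, hfT j⟩, ?_, ?_, ?_⟩
  · intro j
    have h2 : ContinuousLinearMap.adjoint ι.toContinuousLinearMap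
        (ι.toContinuousLinearMap ⟨f j, hfT j⟩) = ⟨f j, hfT j⟩ := by
      refine ext_inner_right ℝ fun y => ?_
      rw [ContinuousLinearMap.adjoint_inner_left]
      exact ι.inner_map_map _ _
    exact congrArg Subtype.val h2
  · refine (ContinuousLinearMap.opNorm_comp_le _ _).trans ?_
    rw [LinearIsometryEquiv.norm_map]
    exact mul_le_one₀ (Submodule.norm_subtypeL_le _) (norm_nonneg _)
      ι.norm_toContinuousLinearMap_le
  · exact fun j => ι.norm_map _

/-- A matrix of rank at most `k` with columns in `V` is a product of a contraction
`ℝ ^ k → V` and a matrix with no larger Frobenius norm. -/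
theorem exists_colImage_eq (F : Matrix (Fin n) (Fin m) ℝ)
    (hV : ∀ j, WithLp.toLp 2 (fun i => F i j) ∈ V) (hF : F.rank ≤ k) :
    ∃ (U : EuclideanSpace ℝ (Fin k) →L[ℝ] V)
      (w : PiLp 2 fun _ : Fin m => EuclideanSpace ℝ (Fin k)),
      colImage U w = F ∧ ‖U‖ ≤ 1 ∧ ‖w‖ ≤ frobNorm F := by
  let g : V →ₗ[ℝ] (Fin n → ℝ) :=
    (WithLp.linearEquiv 2 ℝ (Fin n → ℝ)).toLinearMap ∘ₗ V.subtype
  have hg : Function.Injective g :=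
    (WithLp.linearEquiv 2 ℝ (Fin n → ℝ)).injective.comp V.injective_subtype
  -- The columns span a space of the same dimension whether viewed in `V` or in `Fin n → ℝ`, and
  -- there it is the rank of `F`.
  have hT : Module.finrank ℝ (Submodule.span ℝ (Set.range fun j =>
      (⟨WithLp.toLp 2 (fun i => F i j), hV j⟩ : V))) ≤ k := by
    rw [(Submodule.equivMapOfInjective g hg _).finrank_eq, Submodule.map_span, ← Set.range_comp]
    rw [Matrix.rank_eq_finrank_span_cols] at hF
    exact hF
  obtain ⟨U, w, hUw, hU, hw⟩ := exists_contraction_of_finrank_span_le _ hT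
  refine ⟨U, WithLp.toLp 2 w, ?_, hU, ?_⟩
  · ext i j
    exact congrArg (fun v : V => (v : EuclideanSpace ℝ (Fin n)) i) (hUw j)
  · refine (sq_le_sq₀ (norm_nonneg _) (frobNorm_nonneg _)).1 ?_
    rw [frobNorm_sq, Finset.sum_comm, PiLp.norm_sq_eq_of_L2]
    refine Finset.sum_le_sum fun j _ => le_of_eq ?_
    calc ‖w j‖ ^ 2 = ‖WithLp.toLp 2 (fun i => F i j)‖ ^ 2 := by rw [hw j]; rfl
      _ = _ := EuclideanSpace.real_norm_sq_eq _

/-- A finite family of test matrices that controls the correlation of any matrix `E` with all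
matrices of rank at most `k` and columns in `V`. -/
theorem exists_testSet_rank_le (V : Submodule ℝ (EuclideanSpace ℝ (Fin n))) (k m : ℕ) :
    ∃ A : Finset (Matrix (Fin n) (Fin m) ℝ),
      A.card ≤ 5 ^ (k * Module.finrank ℝ V + k * m) ∧ (∀ a ∈ A, frobNorm a ≤ 1) ∧
      ∀ (E : Matrix (Fin n) (Fin m) ℝ) (t : ℝ), (∀ a ∈ A, |frobInner E a| ≤ t) →
        ∀ F : Matrix (Fin n) (Fin m) ℝ, F.rank ≤ k →
          (∀ j, WithLp.toLp 2 (fun i => F i j) ∈ V) →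
          |frobInner E F| ≤ 4 * t * frobNorm F := by
  classical
  obtain ⟨s, hs, hsc⟩ := exists_isHalfNet (EuclideanSpace ℝ (Fin k) →L[ℝ] V)
  obtain ⟨s', hs', hsc'⟩ := exists_isHalfNet (PiLp 2 fun _ : Fin m => EuclideanSpace ℝ (Fin k))
  refine ⟨(s ×ˢ s').image fun x => colImage x.1 x.2, ?_, ?_, ?_⟩
  · refine Finset.card_image_le.trans ?_
    rw [Finset.card_product, pow_add]
    refine Nat.mul_le_mul (hsc.trans_eq ?_) (hsc'.trans_eq ?_)
    · rw [← (LinearMap.toContinuousLinearMap (𝕜 := ℝ) (E := EuclideanSpace ℝ (Fin k))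
        (F' := V)).finrank_eq, Module.finrank_linearMap, finrank_euclideanSpace_fin]
    · rw [(WithLp.linearEquiv 2 ℝ (Fin m → EuclideanSpace ℝ (Fin k))).finrank_eq,
        Module.finrank_pi_fintype]
      simp [mul_comm]
  · intro a ha
    obtain ⟨⟨U, w⟩, hx, rfl⟩ := Finset.mem_image.1 ha
    obtain ⟨hU, hw⟩ := Finset.mem_product.1 hx
    exact (frobNorm_colImage_le U w).trans
      (mul_le_one₀ (hs.norm_le U hU) (norm_nonneg _) (hs'.norm_le w hw))
  · intro E t ht F hF hV
    obtain ⟨U, w, rfl, hU, hw⟩ := exists_colImage_eq F hV hF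
    have ht' : ∀ c ∈ s, ∀ d ∈ s', |colImageForm (V := V) E c d| ≤ t := fun c hc d hd =>
      ht _ (Finset.mem_image.2 ⟨(c, d), Finset.mem_product.2 ⟨hc, hd⟩, rfl⟩)
    have h0 : 0 ≤ t := by
      obtain ⟨c, hc⟩ := hs.nonempty
      obtain ⟨d, hd, -⟩ := hs'.exists_near 0 (by simp)
      exact (abs_nonneg _).trans (ht' c hc d hd)
    calc |frobInner E (colImage U w)| ≤ 4 * t * ‖U‖ * ‖w‖ :=
          hs.abs_apply_apply_le hs' (colImageForm E) ht' U w
      _ ≤ 4 * t * 1 * frobNorm (colImage U w) := by gcongr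
      _ = _ := by ring

end LowRank

/-! ### Test matrices for matrices supported on given rows. -/

section RowSupport

variable {n m : ℕ}

/-- The matrix with rows in `I` given by `w` and zero elsewhere. -/
def rowFill (I : Finset (Fin n)) (w : EuclideanSpace ℝ (I × Fin m)) :
    Matrix (Fin n) (Fin m) ℝ :=
  Matrix.of fun i j => if h : i ∈ I then w (⟨i, h⟩, j) else 0

theorem sum_dite_mem {M : Type*} [AddCommMonoid M] (I : Finset (Fin n)) (f : I → M) :
    ∑ i, (if h : i ∈ I then f ⟨i, h⟩ else 0) = ∑ i, f i := by
  rw [← Finset.sum_subset (Finset.subset_univ I) (fun i _ hi => dif_neg hi), ← Finset.sum_coe_sort]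
  exact Finset.sum_congr rfl fun i _ => dif_pos i.2

theorem frobNorm_rowFill (I : Finset (Fin n)) (w : EuclideanSpace ℝ (I × Fin m)) :
    frobNorm (rowFill I w) = ‖w‖ := by
  refine (sq_eq_sq₀ (frobNorm_nonneg _) (norm_nonneg _)).1 ?_
  rw [frobNorm_sq, EuclideanSpace.real_norm_sq_eq, Fintype.sum_prod_type,
    ← sum_dite_mem I fun i => ∑ j, w (i, j) ^ 2]
  refine Finset.sum_congr rfl fun i _ => ?_
  by_cases h : i ∈ I <;> simp [rowFill, h]

/-- The linear form `w ↦ ⟨E, rowFill I w⟩`. -/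
noncomputable def rowFillForm (I : Finset (Fin n)) (E : Matrix (Fin n) (Fin m) ℝ) :
    EuclideanSpace ℝ (I × Fin m) →ₗ[ℝ] ℝ where
  toFun w := frobInner E (rowFill I w)
  map_add' v w := by
    rw [← frobInner_add]
    congr 1
    ext i j
    by_cases h : i ∈ I <;> simp [rowFill, h]
  map_smul' c w := by
    simp only [frobInner, RingHom.id_apply, smul_eq_mul, Finset.mul_sum]
    refine Finset.sum_congr rfl fun i _ => Finset.sum_congr rfl fun j _ => ?_
    by_cases h : i ∈ I <;> simp [rowFill, h, mul_left_comm]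

/-- A finite family of test matrices that controls the correlation of any matrix `E` with all
matrices whose nonzero rows lie in `I`. -/
theorem exists_testSet_rows (I : Finset (Fin n)) (m : ℕ) :
    ∃ A : Finset (Matrix (Fin n) (Fin m) ℝ),
      A.card ≤ 5 ^ (I.card * m) ∧ (∀ a ∈ A, frobNorm a ≤ 1) ∧
      ∀ (E : Matrix (Fin n) (Fin m) ℝ) (t : ℝ), (∀ a ∈ A, |frobInner E a| ≤ t) →
        ∀ G : Matrix (Fin n) (Fin m) ℝ, (∀ i ∉ I, G i = 0) →
          |frobInner E G| ≤ 2 * t * frobNorm G := by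
  classical
  obtain ⟨s, hs, hsc⟩ := exists_isHalfNet (EuclideanSpace ℝ (I × Fin m))
  refine ⟨s.image (rowFill I), ?_, ?_, ?_⟩
  · refine Finset.card_image_le.trans (hsc.trans_eq ?_)
    simp
  · intro a ha
    obtain ⟨w, hw, rfl⟩ := Finset.mem_image.1 ha
    exact (frobNorm_rowFill I w).trans_le (hs.norm_le w hw)
  · intro E t ht G hG
    have hw : rowFill I (WithLp.toLp 2 fun x : I × Fin m => G x.1 x.2) = G := by
      ext i j
      by_cases h : i ∈ I <;> simp [rowFill, h, hG]
    rw [← hw, frobNorm_rowFill]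
    exact hs.abs_apply_le (rowFillForm I E)
      (fun c hc => ht _ (Finset.mem_image_of_mem _ hc)) _

end RowSupport

/-! ### Test set for differences of feasible fits, and the basic inequality. -/

section TestSet

variable {n p m : ℕ}

theorem rank_sub_le (A B : Matrix (Fin n) (Fin m) ℝ) : (A - B).rank ≤ A.rank + B.rank := by
  have h : LinearMap.range (A - B).mulVecLin ≤
      LinearMap.range A.mulVecLin ⊔ LinearMap.range B.mulVecLin := by
    rintro _ ⟨v, rfl⟩
    rw [Matrix.mulVecLin_apply, Matrix.sub_mulVec]
    exact Submodule.sub_mem _ (Submodule.mem_sup_left ⟨v, rfl⟩) (Submodule.mem_sup_right ⟨v, rfl⟩)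
  exact (Submodule.finrank_mono h).trans (Submodule.finrank_add_le_finrank_add_finrank _ _)

open Classical in
/-- A finite family of test matrices that controls the correlation of any matrix `E` with all
matrices `X B + C` such that `B` has rank at most `k` and `C` has its nonzero rows in `I`. -/
theorem exists_testSet_support (X : Matrix (Fin n) (Fin p) ℝ) (I : Finset (Fin n)) (k m : ℕ) :
    ∃ A : Finset (Matrix (Fin n) (Fin m) ℝ),
      A.card ≤ 5 ^ (k * X.rank + k * m) + 5 ^ (I.card * m) ∧ (∀ a ∈ A, frobNorm a ≤ 1) ∧
      ∀ (E : Matrix (Fin n) (Fin m) ℝ) (t : ℝ), 0 ≤ t → (∀ a ∈ A, |frobInner E a| ≤ t) →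
        ∀ (B : Matrix (Fin p) (Fin m) ℝ) (C : Matrix (Fin n) (Fin m) ℝ), B.rank ≤ k →
          (∀ i ∉ I, C i = 0) → |frobInner E (X * B + C)| ≤ 6 * t * frobNorm (X * B + C) := by
  -- `X * B` and `C` may nearly cancel, so neither is controlled by their sum. Zeroing the rows in
  -- `I` removes `C` and leaves `(P * X) * B`, while the remainder lives on `I`; both pieces are no
  -- larger than the sum.
  let P : Matrix (Fin n) (Fin n) ℝ := Matrix.diagonal fun i => if i ∈ I then 0 else 1
  have hP : ∀ {l : ℕ} (M : Matrix (Fin n) (Fin l) ℝ) i j,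
      (P * M) i j = if i ∈ I then 0 else M i j := by
    intro l M i j
    simp [P, Matrix.diagonal_mul]
  let V : Submodule ℝ (EuclideanSpace ℝ (Fin n)) := (LinearMap.range (P * X).mulVecLin).map
    (WithLp.linearEquiv 2 ℝ (Fin n → ℝ)).symm.toLinearMap
  have hV : Module.finrank ℝ V ≤ X.rank :=
    (Submodule.finrank_map_le _ _).trans (Matrix.rank_mul_le_right P X)
  obtain ⟨A₁, hc₁, hn₁, h₁⟩ := exists_testSet_rank_le V k m
  obtain ⟨A₂, hc₂, hn₂, h₂⟩ := exists_testSet_rows I m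
  refine ⟨A₁ ∪ A₂, ?_, ?_, ?_⟩
  · refine (Finset.card_union_le _ _).trans (add_le_add (hc₁.trans ?_) hc₂)
    gcongr
    norm_num
  · intro a ha
    rcases Finset.mem_union.1 ha with h | h
    exacts [hn₁ a h, hn₂ a h]
  · intro E t ht0 ht B C hB hC
    set D := X * B + C with hD
    let F : Matrix (Fin n) (Fin m) ℝ := P * D
    let G : Matrix (Fin n) (Fin m) ℝ := D - F
    have hF : F = (P * X) * B := by
      have : P * C = 0 := by
        ext i j
        rw [hP]
        split_ifs with h
        · rfl
        · simp [hC i h]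
      rw [show F = P * (X * B + C) from rfl, Matrix.mul_add, this, add_zero, Matrix.mul_assoc]
    have hFD : frobNorm F ≤ frobNorm D := by
      refine (sq_le_sq₀ (frobNorm_nonneg _) (frobNorm_nonneg _)).1 ?_
      rw [frobNorm_sq, frobNorm_sq]
      refine Finset.sum_le_sum fun i _ => Finset.sum_le_sum fun j _ => ?_
      change (P * D) i j ^ 2 ≤ _
      rw [hP]
      split_ifs
      · simpa using sq_nonneg (D i j)
      · exact le_rfl
    have hGD : frobNorm G ≤ frobNorm D := by
      refine (sq_le_sq₀ (frobNorm_nonneg _) (frobNorm_nonneg _)).1 ?_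
      rw [frobNorm_sq, frobNorm_sq]
      refine Finset.sum_le_sum fun i _ => Finset.sum_le_sum fun j _ => ?_
      change (D i j - (P * D) i j) ^ 2 ≤ _
      rw [hP]
      split_ifs
      · simp
      · simpa using sq_nonneg (D i j)
    have hFr : F.rank ≤ k := by
      rw [hF]
      exact (Matrix.rank_mul_le_right _ _).trans hB
    have hFV : ∀ j, WithLp.toLp 2 (fun i => F i j) ∈ V := by
      intro j
      refine ⟨fun i => F i j, ⟨fun l => B l j, ?_⟩, rfl⟩
      rw [hF]
      rfl
    have hG : ∀ i ∉ I, G i = 0 := by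
      intro i hi
      ext j
      change D i j - (P * D) i j = 0
      rw [hP, if_neg hi, sub_self]
    have hFG : frobInner E D = frobInner E F + frobInner E G := by
      rw [← frobInner_add]
      simp [G]
    rw [hFG]
    calc |frobInner E F + frobInner E G| ≤ |frobInner E F| + |frobInner E G| := abs_add_le _ _
      _ ≤ 4 * t * frobNorm F + 2 * t * frobNorm G := add_le_add
          (h₁ E t (fun a ha => ht a (Finset.mem_union_left _ ha)) F hFr hFV)
          (h₂ E t (fun a ha => ht a (Finset.mem_union_right _ ha)) G hG)
      _ ≤ 4 * t * frobNorm D + 2 * t * frobNorm D := by gcongr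
      _ = _ := by ring

/-- The entropy bound `log (n choose k) ≤ k log (e n / k)`, in exponential form. -/
theorem choose_le_exp (n k : ℕ) (h : k ≤ n) :
    (n.choose k : ℝ) ≤ Real.exp (k * Real.log (Real.exp 1 * n / k)) := by
  rcases Nat.eq_zero_or_pos k with rfl | hk
  · simp
  have hk' : (0 : ℝ) < k := by exact_mod_cast hk
  have hn' : (0 : ℝ) < n := by exact_mod_cast hk.trans_le h
  -- The left side is one term of the binomial expansion of `(1 + k / n) ^ n ≤ e ^ k`.
  have h1 : (n.choose k : ℝ) * (k / n : ℝ) ^ k ≤ Real.exp k := by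
    calc (n.choose k : ℝ) * (k / n : ℝ) ^ k
        ≤ ∑ j ∈ Finset.range (n + 1), (k / n : ℝ) ^ j * 1 ^ (n - j) * n.choose j := by
          refine le_trans (le_of_eq ?_) (Finset.single_le_sum
            (f := fun j => (k / n : ℝ) ^ j * 1 ^ (n - j) * (n.choose j : ℝ))
            (fun j _ => by positivity) (Finset.mem_range.2 (Nat.lt_succ_of_le h)))
          simp [mul_comm]
      _ = (k / n + 1 : ℝ) ^ n := (add_pow _ _ _).symm
      _ ≤ Real.exp (k / n) ^ n := by gcongr; exact Real.add_one_le_exp _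
      _ = Real.exp k := by
          rw [← Real.exp_nat_mul]
          congr 1
          field_simp
  have h2 : Real.exp (k * Real.log (Real.exp 1 * n / k)) = Real.exp k * (n / k : ℝ) ^ k := by
    rw [Real.exp_nat_mul, Real.exp_log (by positivity), mul_div_assoc, mul_pow, ← Real.exp_nat_mul,
      mul_one]
  rw [h2]
  calc (n.choose k : ℝ) = n.choose k * (k / n : ℝ) ^ k * (n / k : ℝ) ^ k := by
        rw [mul_assoc, ← mul_pow, div_mul_div_cancel₀ hn'.ne', div_self hk'.ne', one_pow, mul_one]
    _ ≤ _ := by gcongr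

/-- The row support of a matrix with at most `ϱ` nonzero rows lies in a set of size `ϱ`. -/
theorem exists_support_card_eq {ϱ : ℕ} (h : ϱ ≤ n) (C : Matrix (Fin n) (Fin m) ℝ)
    (hC : rowSparsity C ≤ ϱ) :
    ∃ I ∈ (Finset.univ : Finset (Fin n)).powersetCard ϱ, ∀ i ∉ I, C i = 0 := by
  classical
  have h1 : (Finset.univ.filter fun i => C i ≠ 0).card ≤ ϱ := by
    rw [rowSparsity, Set.ncard_eq_toFinset_card'] at hC
    simpa using hC
  -- The support is padded to exactly `ϱ` rows, so only `n.choose ϱ` sets have to be counted.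
  obtain ⟨I, hI, -, hcard⟩ := Finset.exists_subsuperset_card_eq
    (Finset.subset_univ _) h1 (by simpa using h)
  refine ⟨I, Finset.mem_powersetCard.2 ⟨Finset.subset_univ _, hcard⟩, fun i hi => ?_⟩
  by_contra hne
  exact hi (hI (by simpa using hne))

/-- The effective complexity of the pairs `(B, C)` with `rank B ≤ r` and at most `ϱ` nonzero
rows in `C`. -/
noncomputable def complexity (X : Matrix (Fin n) (Fin p) ℝ) (m r ϱ : ℕ) : ℝ :=
  ((X.rank : ℝ) + m) * r + ϱ * m + ϱ * Real.log (Real.exp 1 * n / ϱ)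

/-- The exponential of this quantity dominates a binomial coefficient, which is at least `1`. The
case `ϱ = 0` is included, the factor `ϱ` then being zero. -/
theorem support_entropy_nonneg {ϱ : ℕ} (h : ϱ ≤ n) :
    0 ≤ (ϱ : ℝ) * Real.log (Real.exp 1 * n / ϱ) := by
  have h1 : (1 : ℝ) ≤ n.choose ϱ := by exact_mod_cast Nat.choose_pos h
  exact Real.exp_le_exp.1 (by simpa using h1.trans (choose_le_exp n ϱ h))

theorem complexity_nonneg (X : Matrix (Fin n) (Fin p) ℝ) (m r : ℕ) {ϱ : ℕ} (h : ϱ ≤ n) :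
    0 ≤ complexity X m r ϱ :=
  add_nonneg (by positivity) (support_entropy_nonneg h)

/-- A finite family of test matrices that controls the correlation of any matrix `E` with all
differences of fitted values `X B + C` over the feasible set. -/
theorem exists_testSet (X : Matrix (Fin n) (Fin p) ℝ) (m r : ℕ) {ϱ : ℕ} (hϱ : ϱ ≤ n) :
    ∃ A : Finset (Matrix (Fin n) (Fin m) ℝ),
      (A.card : ℝ) ≤ Real.exp (4 * complexity X m r ϱ + 1) ∧ (∀ a ∈ A, frobNorm a ≤ 1) ∧
      ∀ (E : Matrix (Fin n) (Fin m) ℝ) (t : ℝ), 0 ≤ t → (∀ a ∈ A, |frobInner E a| ≤ t) →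
        ∀ D ∈ feasible n p m r ϱ, ∀ D' ∈ feasible n p m r ϱ,
          |frobInner E (X * D.1 + D.2 - (X * D'.1 + D'.2))| ≤
            6 * t * frobNorm (X * D.1 + D.2 - (X * D'.1 + D'.2)) := by
  classical
  -- The rank budget is `2 * r` because a difference of two feasible coefficient matrices is tested.
  choose A hc hn hA using fun I : Finset (Fin n) => exists_testSet_support X I (2 * r) m
  let S := (Finset.univ : Finset (Fin n)).powersetCard ϱ
  refine ⟨(S ×ˢ S).biUnion fun I => A (I.1 ∪ I.2), ?_, ?_, ?_⟩
  · have h5 : (5 : ℝ) ≤ Real.exp 2 := by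
      have h2 : Real.exp 2 = Real.exp 1 ^ 2 := by rw [← Real.exp_nat_mul]; norm_num
      have := Real.exp_one_gt_d9
      rw [h2]
      nlinarith
    have h5' : ∀ N : ℕ, (5 : ℝ) ^ N ≤ Real.exp (2 * N) := fun N => by
      calc (5 : ℝ) ^ N ≤ Real.exp 2 ^ N := by gcongr
        _ = _ := by rw [← Real.exp_nat_mul, mul_comm]
    have h2 : (2 : ℝ) ≤ Real.exp 1 := by
      have := Real.add_one_le_exp (1 : ℝ)
      linarith
    -- The factor `4` is the doubling of rank and support times the `2` in `5 ≤ e ^ 2`; the `+ 1`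
    -- absorbs the sum of two equal exponentials, by `2 ≤ e`.
    have hcard : ∀ I ∈ S ×ˢ S,
        ((A (I.1 ∪ I.2)).card : ℝ) ≤ Real.exp (4 * ((X.rank + m) * r + ϱ * m) + 1) := by
      intro I hI
      obtain ⟨h1, h2⟩ := Finset.mem_product.1 hI
      have hI' : (I.1 ∪ I.2).card ≤ 2 * ϱ := by
        have := Finset.card_union_le I.1 I.2
        rw [(Finset.mem_powersetCard.1 h1).2, (Finset.mem_powersetCard.1 h2).2] at this
        omega
      calc ((A (I.1 ∪ I.2)).card : ℝ)
          ≤ (5 : ℝ) ^ (2 * r * X.rank + 2 * r * m) + 5 ^ ((I.1 ∪ I.2).card * m) := by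
            exact_mod_cast hc (I.1 ∪ I.2)
        _ ≤ (5 : ℝ) ^ (2 * r * X.rank + 2 * r * m) + 5 ^ (2 * ϱ * m) := by
            gcongr
            norm_num
        _ ≤ Real.exp (4 * ((X.rank + m) * r + ϱ * m)) +
            Real.exp (4 * ((X.rank + m) * r + ϱ * m)) := by
            refine add_le_add ((h5' _).trans (Real.exp_le_exp.2 ?_))
              ((h5' _).trans (Real.exp_le_exp.2 ?_))
            · push_cast
              have : (0 : ℝ) ≤ ϱ * m := by positivity
              linarith
            · push_cast
              have : (0 : ℝ) ≤ (X.rank + m) * r := by positivity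
              linarith
        _ = 2 * Real.exp (4 * ((X.rank + m) * r + ϱ * m)) := by ring
        _ ≤ Real.exp 1 * Real.exp (4 * ((X.rank + m) * r + ϱ * m)) := by gcongr
        _ = _ := by rw [← Real.exp_add, add_comm]
    have hS : (S.card : ℝ) ≤ Real.exp (ϱ * Real.log (Real.exp 1 * n / ϱ)) := by
      simpa [S] using choose_le_exp n ϱ hϱ
    have hL := support_entropy_nonneg hϱ
    calc (((S ×ˢ S).biUnion fun I => A (I.1 ∪ I.2)).card : ℝ)
        ≤ ∑ I ∈ S ×ˢ S, ((A (I.1 ∪ I.2)).card : ℝ) := by exact_mod_cast Finset.card_biUnion_le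
      _ ≤ ∑ I ∈ S ×ˢ S, Real.exp (4 * ((X.rank + m) * r + ϱ * m) + 1) := Finset.sum_le_sum hcard
      _ = S.card * S.card * Real.exp (4 * ((X.rank + m) * r + ϱ * m) + 1) := by
          simp [Finset.card_product]
      _ ≤ Real.exp (ϱ * Real.log (Real.exp 1 * n / ϱ)) *
          Real.exp (ϱ * Real.log (Real.exp 1 * n / ϱ)) *
          Real.exp (4 * ((X.rank + m) * r + ϱ * m) + 1) := by gcongr
      _ ≤ _ := by
          rw [← Real.exp_add, ← Real.exp_add]
          refine Real.exp_le_exp.2 ?_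
          rw [complexity]
          linarith
  · intro a ha
    obtain ⟨I, -, hI⟩ := Finset.mem_biUnion.1 ha
    exact hn _ a hI
  · intro E t ht0 ht D hD D' hD'
    obtain ⟨I, hI, hIC⟩ := exists_support_card_eq hϱ D.2 hD.2
    obtain ⟨I', hI', hIC'⟩ := exists_support_card_eq hϱ D'.2 hD'.2
    have hsub : X * D.1 + D.2 - (X * D'.1 + D'.2) = X * (D.1 - D'.1) + (D.2 - D'.2) := by
      rw [Matrix.mul_sub]
      abel
    rw [hsub]
    refine hA (I ∪ I') E t ht0 (fun a ha => ht a (Finset.mem_biUnion.2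
      ⟨(I, I'), Finset.mem_product.2 ⟨hI, hI'⟩, ha⟩)) _ _ ?_ ?_
    · have := rank_sub_le D.1 D'.1
      have h1 := hD.1
      have h2 := hD'.1
      omega
    · intro i hi
      rw [Finset.mem_union, not_or] at hi
      change D.2 i - D'.2 i = 0
      rw [hIC i hi.1, hIC' i hi.2, sub_zero]

/-- The basic inequality for a global minimizer, with the stochastic term bounded by `t`. -/
theorem predError_le_of_isSolution {X : Matrix (Fin n) (Fin p) ℝ} {r ϱ : ℕ}
    {Bstar : Matrix (Fin p) (Fin m) ℝ} {Cstar E : Matrix (Fin n) (Fin m) ℝ}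
    {D : Matrix (Fin p) (Fin m) ℝ × Matrix (Fin n) (Fin m) ℝ}
    (hD : IsSolution X (X * Bstar + Cstar + E) r ϱ D) {t : ℝ}
    (ht : ∀ D' ∈ feasible n p m r ϱ,
      |frobInner E (X * D.1 + D.2 - (X * D'.1 + D'.2))| ≤
        t * frobNorm (X * D.1 + D.2 - (X * D'.1 + D'.2))) :
    predError X (D.1 - Bstar) (D.2 - Cstar) ≤
      4 * bestApproxError X Bstar Cstar r ϱ + 6 * t ^ 2 := by
  have key : ∀ D' ∈ feasible n p m r ϱ, predError X (D.1 - Bstar) (D.2 - Cstar) ≤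
      4 * predError X (D'.1 - Bstar) (D'.2 - Cstar) + 6 * t ^ 2 := by
    intro D' hD'
    set a := X * (D.1 - Bstar) + (D.2 - Cstar) with ha
    set b := X * (D'.1 - Bstar) + (D'.2 - Cstar) with hb
    have hab : X * D.1 + D.2 - (X * D'.1 + D'.2) = a - b := by
      rw [ha, hb, Matrix.mul_sub, Matrix.mul_sub]
      abel
    have h1 : X * Bstar + Cstar + E - X * D.1 - D.2 = E - a := by
      rw [ha, Matrix.mul_sub]
      abel
    have h2 : X * Bstar + Cstar + E - X * D'.1 - D'.2 = E - b := by
      rw [hb, Matrix.mul_sub]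
      abel
    -- Optimality reads `‖E - a‖ ^ 2 ≤ ‖E - b‖ ^ 2`, that is, `‖a‖ ^ 2 ≤ ‖b‖ ^ 2 + 2 ⟨E, a - b⟩`.
    have hmin := isMinOn_iff.1 hD.2 D' hD'
    simp only [h1, h2, frobNorm_sub_sq] at hmin
    have h3 := ht D' hD'
    rw [hab] at h3
    have h4 : frobInner E (a - b) = frobInner E a - frobInner E b := by
      have := frobInner_add E (a - b) b
      rw [sub_add_cancel] at this
      linarith
    have h5 := frobNorm_sub_le a b
    have h6 := le_abs_self (frobInner E (a - b))
    have h7 := frobNorm_nonneg (a - b)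
    change frobNorm a ^ 2 ≤ 4 * frobNorm b ^ 2 + 6 * t ^ 2
    have h8 : t * frobNorm (a - b) ≤ |t| * (frobNorm a + frobNorm b) :=
      mul_le_mul (le_abs_self t) h5 h7 (abs_nonneg t)
    have h9 := sq_abs t
    -- Uses `2|t|‖a‖ ≤ ‖a‖ ^ 2 / 2 + 2 t ^ 2` and `2|t|‖b‖ ≤ ‖b‖ ^ 2 + t ^ 2`, then doubles.
    nlinarith [sq_nonneg (frobNorm a - 2 * |t|), sq_nonneg (frobNorm b - |t|)]
  have hne : (feasible n p m r ϱ).Nonempty := ⟨D, hD.1⟩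
  have : (predError X (D.1 - Bstar) (D.2 - Cstar) - 6 * t ^ 2) / 4 ≤
      bestApproxError X Bstar Cstar r ϱ := by
    refine le_csInf (hne.image _) ?_
    rintro _ ⟨D', hD', rfl⟩
    have := key D' hD'
    dsimp only
    linarith
  linarith

end TestSet

/-! ### Maximal inequality from sub-Gaussian tails. -/

section Expectation

variable {n m : ℕ} {Ω : Type*} [MeasurableSpace Ω] {μ : Measure Ω}

/-- Integrated form of a sub-Gaussian tail beyond the level `s`. -/
theorem lintegral_sq_sub_le {ξ : Ω → ℝ} (hξ : AEMeasurable ξ μ) {σ : ℝ} (hσ : 0 ≤ σ)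
    (htail : ∀ t : ℝ, 0 ≤ t → μ {ω | σ * t < |ξ ω|} ≤ ENNReal.ofReal (2 * Real.exp (-t ^ 2 / 2)))
    {s : ℝ} (hs : 0 ≤ s) :
    ∫⁻ ω, ENNReal.ofReal (ξ ω ^ 2 - σ ^ 2 * s) ∂μ
      ≤ ENNReal.ofReal (4 * σ ^ 2 * Real.exp (-s / 2)) := by
  rcases hσ.eq_or_lt with rfl | hσ
  -- For `σ = 0` the threshold is zero for every `t`, so letting `t → ∞` forces `ξ = 0` almost
  -- everywhere.
  · have h0 : μ {ω | 0 < |ξ ω|} = 0 := by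
      refine le_antisymm (ge_of_tendsto' (x := Filter.atTop) (f := fun N : ℕ =>
        ENNReal.ofReal (2 * Real.exp (-(N : ℝ) ^ 2 / 2))) ?_ fun N => ?_) zero_le
      · rw [← ENNReal.ofReal_zero]
        refine ENNReal.tendsto_ofReal ?_
        rw [show (0 : ℝ) = 2 * 0 by ring]
        refine Filter.Tendsto.const_mul _ (Real.tendsto_exp_atBot.comp ?_)
        have hsq : Filter.Tendsto (fun N : ℕ => (N : ℝ) ^ 2 / 2) Filter.atTop Filter.atTop :=
          ((Filter.tendsto_pow_atTop two_ne_zero).comp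
            tendsto_natCast_atTop_atTop).atTop_div_const two_pos
        simpa [neg_div] using hsq
      · simpa using htail N N.cast_nonneg
    have h1 : ∀ᵐ ω ∂μ, ENNReal.ofReal (ξ ω ^ 2 - 0 ^ 2 * s) = 0 := by
      refine measure_mono_null (fun ω hω => ?_) h0
      simp only [Set.mem_ofPred_eq, abs_pos]
      rintro h
      exact hω (by simp [h])
    rw [lintegral_congr_ae h1]
    simp
  · have hpos : ∀ ω, ENNReal.ofReal (ξ ω ^ 2 - σ ^ 2 * s) =
        ENNReal.ofReal (σ ^ 2) * ENNReal.ofReal (max ((ξ ω / σ) ^ 2 - s) 0) := by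
      intro ω
      rw [← ENNReal.ofReal_mul (by positivity), mul_max_of_nonneg _ _ (by positivity), mul_zero,
        ENNReal.ofReal_max, ENNReal.ofReal_zero, max_eq_left zero_le]
      congr 1
      field_simp
    simp_rw [hpos]
    rw [lintegral_const_mul' _ _ ENNReal.ofReal_ne_top,
      lintegral_eq_lintegral_meas_lt μ
        (f := fun ω => max ((ξ ω / σ) ^ 2 - s) 0)
        (Filter.Eventually.of_forall fun ω => le_max_right _ _)
        ((((hξ.div_const σ).pow_const 2).sub_const s).max aemeasurable_const)]
    -- Layer-cake formula: the tail at `t = √(s + u)` is `2 e ^ (-(s + u) / 2)`, whose integral over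
    -- `u > 0` is `4 e ^ (-s / 2)`.
    have hmeas : ∀ u ∈ Set.Ioi (0 : ℝ), μ {ω | u < max ((ξ ω / σ) ^ 2 - s) 0} ≤
        ENNReal.ofReal (2 * Real.exp (-s / 2) * Real.exp (-(1 / 2) * u)) := by
      intro u hu
      have hu : 0 < u := hu
      calc μ {ω | u < max ((ξ ω / σ) ^ 2 - s) 0}
          ≤ μ {ω | σ * Real.sqrt (s + u) < |ξ ω|} := by
            refine measure_mono fun ω hω => ?_
            have h1 : u < (ξ ω / σ) ^ 2 - s := by
              rcases lt_max_iff.1 (show u < max ((ξ ω / σ) ^ 2 - s) 0 from hω) with h | h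
              · exact h
              · linarith
            have h2 : Real.sqrt (s + u) < |ξ ω / σ| := by
              rw [← Real.sqrt_sq_eq_abs]
              exact Real.sqrt_lt_sqrt (by linarith) (by linarith)
            rw [abs_div, abs_of_pos hσ, lt_div_iff₀ hσ, mul_comm] at h2
            exact h2
        _ ≤ _ := htail _ (Real.sqrt_nonneg _)
        _ = _ := by
            rw [Real.sq_sqrt (by linarith), mul_assoc, ← Real.exp_add]
            ring_nf
    calc ENNReal.ofReal (σ ^ 2) * ∫⁻ u in Set.Ioi 0, μ {ω | u < max ((ξ ω / σ) ^ 2 - s) 0}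
        ≤ ENNReal.ofReal (σ ^ 2) * ∫⁻ u in Set.Ioi (0 : ℝ),
            ENNReal.ofReal (2 * Real.exp (-s / 2) * Real.exp (-(1 / 2) * u)) := by
          gcongr 1
          exact setLIntegral_mono' measurableSet_Ioi hmeas
      _ = ENNReal.ofReal (σ ^ 2) * ENNReal.ofReal (4 * Real.exp (-s / 2)) := by
          rw [← ofReal_integral_eq_lintegral_ofReal
            ((integrableOn_exp_mul_Ioi (by norm_num) 0).const_mul _)
            (Filter.Eventually.of_forall fun u => by positivity), integral_const_mul,
            integral_exp_mul_Ioi (by norm_num)]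
          simp only [mul_zero, Real.exp_zero]
          ring_nf
      _ = _ := by
          rw [← ENNReal.ofReal_mul (by positivity)]
          ring_nf

theorem measurable_frobInner (a : Matrix (Fin n) (Fin m) ℝ) :
    Measurable fun E : Matrix (Fin n) (Fin m) ℝ => frobInner E a := by
  unfold frobInner
  refine Finset.measurable_sum _ fun i _ => Finset.measurable_sum _ fun j _ => ?_
  exact ((measurable_pi_apply j).comp
    (measurable_pi_apply (X := fun _ : Fin n => Fin m → ℝ) i)).mul_const _

/-- A maximal inequality: the supremum of `⟨E, a⟩ ^ 2` over at most `e ^ H` matrices of unit norm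
has expectation at most `σ ^ 2 (2 H + 4)`. -/
theorem IsSubGaussian.lintegral_max_sq_le [IsProbabilityMeasure μ]
    {E : Ω → Matrix (Fin n) (Fin m) ℝ} {σ : ℝ} (hE : IsSubGaussian E σ μ) (hσ : 0 ≤ σ)
    {A : Finset (Matrix (Fin n) (Fin m) ℝ)} (hA : ∀ a ∈ A, frobNorm a ≤ 1) {H : ℝ} (hH : 0 ≤ H)
    (hcard : (A.card : ℝ) ≤ Real.exp H) :
    ∫⁻ ω, ENNReal.ofReal (σ ^ 2 * (2 * H)) +
        ∑ a ∈ A, ENNReal.ofReal (frobInner (E ω) a ^ 2 - σ ^ 2 * (2 * H)) ∂μ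
      ≤ ENNReal.ofReal (σ ^ 2 * (2 * H + 4)) := by
  have hmeas : ∀ a, AEMeasurable (fun ω => frobInner (E ω) a) μ := fun a =>
    (measurable_frobInner a).comp_aemeasurable hE.aemeasurable
  have h1 : ∀ a ∈ A, ∫⁻ ω, ENNReal.ofReal (frobInner (E ω) a ^ 2 - σ ^ 2 * (2 * H)) ∂μ ≤
      ENNReal.ofReal (4 * σ ^ 2 * Real.exp (-H)) := by
    intro a ha
    -- At level `s = 2 H` each expected excess carries `e ^ (-H)`, which cancels the cardinality
    -- bound `e ^ H` in the sum over `A`.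
    have := lintegral_sq_sub_le (hmeas a) hσ (s := 2 * H) (fun t ht => ?_) (by positivity)
    · rwa [show -(2 * H) / 2 = -H by ring] at this
    · refine (measure_mono fun ω hω => ?_).trans (hE.tail a t ht)
      refine lt_of_le_of_lt ?_ (show σ * t < |frobInner (E ω) a| from hω)
      have := mul_le_of_le_one_right (mul_nonneg hσ ht) (hA a ha)
      linarith
  rw [lintegral_add_left measurable_const, lintegral_const, measure_univ, mul_one,
    lintegral_finsetSum' _ fun a _ => (((hmeas a).pow_const 2).sub_const _).ennreal_ofReal]
  calc ENNReal.ofReal (σ ^ 2 * (2 * H)) +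
        ∑ a ∈ A, ∫⁻ ω, ENNReal.ofReal (frobInner (E ω) a ^ 2 - σ ^ 2 * (2 * H)) ∂μ
      ≤ ENNReal.ofReal (σ ^ 2 * (2 * H)) + ∑ a ∈ A, ENNReal.ofReal (4 * σ ^ 2 * Real.exp (-H)) := by
        gcongr with a ha
        exact h1 a ha
    _ = ENNReal.ofReal (σ ^ 2 * (2 * H) + A.card * (4 * σ ^ 2 * Real.exp (-H))) := by
        rw [Finset.sum_const, nsmul_eq_mul, ENNReal.ofReal_add (by positivity) (by positivity),
          ENNReal.ofReal_mul (p := (A.card : ℝ)) (by positivity), ENNReal.ofReal_natCast]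
    _ ≤ _ := by
        refine ENNReal.ofReal_le_ofReal ?_
        calc σ ^ 2 * (2 * H) + A.card * (4 * σ ^ 2 * Real.exp (-H))
            ≤ σ ^ 2 * (2 * H) + Real.exp H * (4 * σ ^ 2 * Real.exp (-H)) := by gcongr
          _ = σ ^ 2 * (2 * H) + 4 * σ ^ 2 * (Real.exp H * Real.exp (-H)) := by ring
          _ = _ := by rw [← Real.exp_add, add_neg_cancel, Real.exp_zero]; ring

end Expectation

/-! ### Oracle inequality and finiteness of the worst-case risk. -/

section OracleInequality

variable {n p m : ℕ}

theorem predError_nonneg (X : Matrix (Fin n) (Fin p) ℝ) (B : Matrix (Fin p) (Fin m) ℝ)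
    (C : Matrix (Fin n) (Fin m) ℝ) : 0 ≤ predError X B C :=
  sq_nonneg _

theorem bestApproxError_nonneg (X : Matrix (Fin n) (Fin p) ℝ) (Bstar : Matrix (Fin p) (Fin m) ℝ)
    (Cstar : Matrix (Fin n) (Fin m) ℝ) (r ϱ : ℕ) : 0 ≤ bestApproxError X Bstar Cstar r ϱ :=
  Real.sInf_nonneg (by rintro _ ⟨D, -, rfl⟩; exact predError_nonneg _ _ _)

theorem bestApproxError_le {X : Matrix (Fin n) (Fin p) ℝ} {Bstar : Matrix (Fin p) (Fin m) ℝ}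
    {Cstar : Matrix (Fin n) (Fin m) ℝ} {r ϱ : ℕ}
    {D : Matrix (Fin p) (Fin m) ℝ × Matrix (Fin n) (Fin m) ℝ} (hD : D ∈ feasible n p m r ϱ) :
    bestApproxError X Bstar Cstar r ϱ ≤ predError X (D.1 - Bstar) (D.2 - Cstar) :=
  csInf_le ⟨0, by rintro _ ⟨D', -, rfl⟩; exact predError_nonneg _ _ _⟩ ⟨D, hD, rfl⟩

/-- The oracle inequality for the doubly constrained robust reduced-rank regression estimator. -/
theorem lintegral_predError_le (X : Matrix (Fin n) (Fin p) ℝ) {r ϱ : ℕ} (hϱ : ϱ ≤ n)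
    (Bstar : Matrix (Fin p) (Fin m) ℝ) (Cstar : Matrix (Fin n) (Fin m) ℝ) {σ : ℝ} (hσ : 0 ≤ σ)
    {Ω : Type*} [MeasurableSpace Ω] {μ : Measure Ω} [IsProbabilityMeasure μ]
    {E : Ω → Matrix (Fin n) (Fin m) ℝ} (hE : IsSubGaussian E σ μ)
    {Bhat : Ω → Matrix (Fin p) (Fin m) ℝ} {Chat : Ω → Matrix (Fin n) (Fin m) ℝ}
    (hsol : ∀ᵐ ω ∂μ, IsSolution X (X * Bstar + Cstar + E ω) r ϱ (Bhat ω, Chat ω)) :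
    ∫⁻ ω, ENNReal.ofReal (predError X (Bhat ω - Bstar) (Chat ω - Cstar)) ∂μ
      ≤ ENNReal.ofReal (2000 * (bestApproxError X Bstar Cstar r ϱ
          + σ ^ 2 * complexity X m r ϱ + σ ^ 2)) := by
  obtain ⟨A, hcard, hnorm, hA⟩ := exists_testSet X m r hϱ
  have hc := complexity_nonneg X m r hϱ
  have hb := bestApproxError_nonneg X Bstar Cstar r ϱ
  set c := complexity X m r ϱ
  set β := bestApproxError X Bstar Cstar r ϱ
  set H : ℝ := 4 * c + 1 with hHdef
  have hH : 0 ≤ H := by positivity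
  -- The dominating function depends on `ω` only through `E ω`, so no measurability of the estimator
  -- is required. The constant is `216 = 6 * 6 ^ 2`, from `6 t ^ 2` with `t = 6 √R`.
  have hbound : ∀ᵐ ω ∂μ, ENNReal.ofReal (predError X (Bhat ω - Bstar) (Chat ω - Cstar)) ≤
      ENNReal.ofReal (4 * β) + ENNReal.ofReal 216 * (ENNReal.ofReal (σ ^ 2 * (2 * H)) +
        ∑ a ∈ A, ENNReal.ofReal (frobInner (E ω) a ^ 2 - σ ^ 2 * (2 * H))) := by
    filter_upwards [hsol] with ω hω
    -- A level plus the sum of all excesses over it dominates every squared correlation, hence their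
    -- maximum.
    set R : ℝ := σ ^ 2 * (2 * H) + ∑ a ∈ A, max (frobInner (E ω) a ^ 2 - σ ^ 2 * (2 * H)) 0
      with hRdef
    have hR : 0 ≤ R := add_nonneg (by positivity) (Finset.sum_nonneg fun a _ => le_max_right _ _)
    have htest : ∀ a ∈ A, |frobInner (E ω) a| ≤ Real.sqrt R := by
      intro a ha
      refine Real.abs_le_sqrt ?_
      have h1 := Finset.single_le_sum (f := fun a => max (frobInner (E ω) a ^ 2 - σ ^ 2 * (2 * H)) 0)
        (fun a _ => le_max_right _ _) ha
      have h2 := le_max_left (frobInner (E ω) a ^ 2 - σ ^ 2 * (2 * H)) 0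
      linarith
    have h3 := predError_le_of_isSolution hω (t := 6 * Real.sqrt R) fun D' hD' =>
      hA (E ω) _ (Real.sqrt_nonneg R) htest _ hω.1 D' hD'
    have h4 : ENNReal.ofReal R = ENNReal.ofReal (σ ^ 2 * (2 * H)) +
        ∑ a ∈ A, ENNReal.ofReal (frobInner (E ω) a ^ 2 - σ ^ 2 * (2 * H)) := by
      rw [hRdef, ENNReal.ofReal_add (by positivity)
        (Finset.sum_nonneg fun a _ => le_max_right _ _),
        ENNReal.ofReal_sum_of_nonneg fun a _ => le_max_right _ _]
      simp [ENNReal.ofReal_max]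
    rw [← h4, ← ENNReal.ofReal_mul (by norm_num), ← ENNReal.ofReal_add (by positivity)
      (by positivity)]
    refine ENNReal.ofReal_le_ofReal (h3.trans_eq ?_)
    rw [mul_pow, Real.sq_sqrt hR]
    ring
  refine (lintegral_mono_ae hbound).trans ?_
  rw [lintegral_add_left measurable_const, lintegral_const, measure_univ, mul_one,
    lintegral_const_mul' _ _ ENNReal.ofReal_ne_top]
  calc _ ≤ ENNReal.ofReal (4 * β) +
        ENNReal.ofReal 216 * ENNReal.ofReal (σ ^ 2 * (2 * H + 4)) := by
        gcongr
        exact hE.lintegral_max_sq_le hσ hnorm hH hcard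
    _ = ENNReal.ofReal (4 * β + 216 * (σ ^ 2 * (2 * H + 4))) := by
        rw [← ENNReal.ofReal_mul (by norm_num), ← ENNReal.ofReal_add (by positivity)
          (by positivity)]
    _ ≤ _ := by
        -- With `H = 4 c + 1` the bound is `4 β + 1728 σ ^ 2 c + 1296 σ ^ 2`; `2000` is a round
        -- majorant.
        refine ENNReal.ofReal_le_ofReal ?_
        have : 0 ≤ σ ^ 2 * c := by positivity
        have := sq_nonneg σ
        rw [hHdef]
        linarith

/-- The worst-case risk with at most `ϱ` contaminated rows is finite. -/
theorem worstRisk_lt_top (X : Matrix (Fin n) (Fin p) ℝ) {r ϱ k : ℕ} (hϱ : ϱ ≤ n) (hk : k ≤ ϱ)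
    (B : Matrix (Fin p) (Fin m) ℝ) {σ : ℝ} (hσ : 0 ≤ σ)
    {est : Matrix (Fin n) (Fin m) ℝ → Matrix (Fin p) (Fin m) ℝ × Matrix (Fin n) (Fin m) ℝ}
    (hest : ∀ Y, IsSolution X Y r ϱ (est Y)) : worstRisk X est B σ k < ∞ := by
  refine lt_of_le_of_lt (b := ENNReal.ofReal (2000 * (predError X (0 - B) 0
    + σ ^ 2 * complexity X m r ϱ + σ ^ 2))) ?_ ENNReal.ofReal_lt_top
  refine iSup₂_le fun C hC => iSup_le fun ν => iSup₂_le fun _ hν => ?_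
  refine (lintegral_predError_le X hϱ B C hσ hν
    (Filter.Eventually.of_forall fun E => hest (X * B + C + E))).trans ?_
  refine ENNReal.ofReal_le_ofReal ?_
  -- This competitor absorbs the contamination entirely, leaving an approximation error that does
  -- not depend on `C`.
  have h0 : ((0, C) : Matrix (Fin p) (Fin m) ℝ × Matrix (Fin n) (Fin m) ℝ) ∈ feasible n p m r ϱ :=
    ⟨by simp, hC.trans hk⟩
  have := bestApproxError_le (X := X) (Bstar := B) (Cstar := C) h0
  simp only [sub_self] at this
  linarith

end OracleInequality

end RobustRRR

theorem theorem4 :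
    -- the oracle inequality, with a universal constant
    (∃ K : ℝ, 0 < K ∧
      ∀ (n p m r ϱ : ℕ) (X : Matrix (Fin n) (Fin p) ℝ)
        (Bstar : Matrix (Fin p) (Fin m) ℝ) (Cstar : Matrix (Fin n) (Fin m) ℝ) (σ : ℝ)
        (Ω : Type*) [MeasurableSpace Ω] (μ : Measure Ω) [IsProbabilityMeasure μ]
        (E : Ω → Matrix (Fin n) (Fin m) ℝ)
        (Bhat : Ω → Matrix (Fin p) (Fin m) ℝ) (Chat : Ω → Matrix (Fin n) (Fin m) ℝ),
        ϱ ≤ n → 0 ≤ σ → RobustRRR.IsSubGaussian E σ μ →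
        (∀ᵐ ω ∂μ, RobustRRR.IsSolution X (X * Bstar + Cstar + E ω) r ϱ (Bhat ω, Chat ω)) →
        ∫⁻ ω, ENNReal.ofReal
            (RobustRRR.predError X (Bhat ω - Bstar) (Chat ω - Cstar)) ∂μ
          ≤ ENNReal.ofReal (K *
              (RobustRRR.bestApproxError X Bstar Cstar r ϱ
                + σ ^ 2 * (((X.rank : ℝ) + m) * r + ϱ * m
                    + ϱ * Real.log (Real.exp 1 * n / ϱ))
                + σ ^ 2)))
    ∧
    -- the lower bound on the risk-based breakdown point
    (∀ (n p m r ϱ : ℕ) (X : Matrix (Fin n) (Fin p) ℝ) (B : Matrix (Fin p) (Fin m) ℝ) (σ : ℝ)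
        (est : Matrix (Fin n) (Fin m) ℝ →
          Matrix (Fin p) (Fin m) ℝ × Matrix (Fin n) (Fin m) ℝ),
        ϱ ≤ n → 0 ≤ σ → (∀ Y, RobustRRR.IsSolution X Y r ϱ (est Y)) →
        ((ϱ : ℝ≥0∞) + 1) / n ≤ RobustRRR.breakdownPoint X est B σ) := by
  refine ⟨⟨2000, by norm_num, ?_⟩, ?_⟩
  · intro n p m r ϱ X Bstar Cstar σ Ω _ μ _ E Bhat Chat hϱ hσ hE hsol
    exact RobustRRR.lintegral_predError_le X hϱ Bstar Cstar hσ hE hsol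
  · intro n p m r ϱ X B σ est hϱ hσ hest
    refine le_iInf₂ fun k hk => ENNReal.div_le_div_right ?_ _
    have : ϱ + 1 ≤ k := by
      by_contra! h
      exact (RobustRRR.worstRisk_lt_top X hϱ (Nat.lt_succ_iff.1 h) B hσ hest).ne hk
    exact_mod_cast this
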